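/- Let $G=(V,E)$ be a finite acyclic directed network (parallel channels allowed, all channels of unit capacity) with a single source node $s$, which has no incoming channels. Let $\omega\ge 1$ be an integer and $\mathcal F$ a field. Let $d_1',\dots,d_\omega'$ be imaginary message channels; put $In(s)=\{d_1',\dots,d_\omega'\}$ and, for $v\ne s$, let $In(v)$ be the set of channels with head $v$. For $t\neq s$ let $C_t$ be the minimum cut capacity between $s$ and $t$, that is, the least number of channels whose removal leaves no directed path from $s$ to $t$, and let $\delta_t=C_t-\omega$. An $\omega$-dimensional $\mathcal F$-valued linear network error correction (LNEC) code on $G$ consists of coefficients $k_{d,e}\in\mathcal F$ ($e\in E$, $d\in In(tail(e))$) together with the column vectors $\tilde f_e\in\mathcal F^{In(s)\cup E}$, $e\in E$, determined by $$\tilde f_e=\sum_{d\in In(tail(e))}k_{d,e}\tilde f_d+1_e,\qquad \tilde f_{d_i'}=1_{d_i'}\quad(1\le i\le\omega),$$ where $1_d$ is the indicator vector of $d$. For $t\neq s$ and $d\in In(s)\cup E$ let $row_t(d)=(\tilde f_e(d))_{e\in In(t)}$. For an error pattern $\rho\subseteq E$ put $\Phi(t)=\langle row_t(d_i'):1\le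 i\le\omega\rangle$ and $\Delta(t,\rho)=\langle row_t(e):e\in\rho\rangle$, and put $$d_{\min}^{(t)}=\min\{|\rho|:\Delta(t,\rho)\cap\Phi(t)\ne\{0\}\}.$$ The code is an LNEC broadcast MDS code if $\dim\Phi(t)=\min\{\omega,C_t\}$ for every $t\ne s$ and, for every $t\neq s$ with $C_t\ge1$, the weakly extended Singleton bound holds with equality: $d_{\min}^{(t)}=\delta_t+1$ if $C_t\ge\omega$, and $d_{\min}^{(t)}=1$ if $C_t<\omega$. (If $C_t=0$, then $\Phi(t)=\{0\}$ and $d_{\min}^{(t)}$ is not defined.) Write $\rho\prec_t\rho'$ if $\Delta(t,\rho)\subseteq\Delta(t,\rho')$ for every $\omega$-dimensional $\mathcal F$-valued LNEC code on $G$, let $rank_t(\rho)=\min\{|\rho'|:\rho\prec_t\rho'\}$, and, for $C_t\ge\omega$, let $R_t(\delta_t)=\{\rho\subseteq E:|\rho|=rank_t(\rho)=\delta_t\}$. Let $V_2$ be the set of non-source nodes $t$ with $C_t<\omega$. Theorem. If $$|\mathcal F|>\sum_{t\in V\setminus\{s\}:\ C_t\ge\omega}|R_t(\delta_t)|+|V_2|,$$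 then there exists an $\omega$-dimensional $\mathcal F$-valued LNEC broadcast MDS code on $G$. -/

import Mathlib

/-- A single-source acyclic network with node set `V` and channel set `E`. Parallel channels are
allowed and every channel has capacity one. The source has no (real) incoming channels. -/
structure AcyclicNetwork (V E : Type*) where
  source : V
  tail : E → V
  head : E → V
  acyclic : ∀ v : V, ¬ Relation.TransGen (fun i j => ∃ e : E, tail e = i ∧ head e = j) v v
  head_ne_source : ∀ e : E, head e ≠ source

namespace AcyclicNetwork

variable {V E : Type*}

/-- `B` is a cut between the source and `t`: once the channels of `B` are removed, no directed
path leads from the source to `t`. -/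
def IsCut (G : AcyclicNetwork V E) (t : V) (B : Finset E) : Prop :=
  ¬ Relation.ReflTransGen (fun i j => ∃ e : E, e ∉ B ∧ G.tail e = i ∧ G.head e = j) G.source t

/-- The minimum cut capacity `C_t` between the source and a non-source node `t`. -/
noncomputable def minCut (G : AcyclicNetwork V E) (t : V) : ℕ :=
  sInf {n : ℕ | ∃ B : Finset E, G.IsCut t B ∧ B.card = n}

open Classical in
/-- `In(v)`, as a set of channels in `In(s) ∪ E`: the incoming channels of `v` when `v` is not the
source, and the `ω` imaginary message channels `Sum.inl i` when `v` is the source. -/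
noncomputable def inChannels [Fintype E] (G : AcyclicNetwork V E) (ω : ℕ) (v : V) :
    Finset (Fin ω ⊕ E) :=
  Finset.univ.filter
    (fun d => Sum.elim (fun _ : Fin ω => v = G.source) (fun e : E => G.head e = v) d)

open Classical in
/-- An `ω`-dimensional `F`-valued linear network error correction code on `G`: local encoding
coefficients `coeff d e` (of which only those with `d ∈ In(tail e)` are used) and extended global
encoding kernels `kernel e` indexed by `In(s) ∪ E`, related by
`kernel e = ∑_{d ∈ In(tail e)} coeff d e • kernel d + 1_e`, where the kernel of an imaginary message
channel is its indicator vector. -/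
structure Code [Fintype E] (G : AcyclicNetwork V E) (ω : ℕ) (F : Type*) [Field F] where
  coeff : Fin ω ⊕ E → E → F
  kernel : E → (Fin ω ⊕ E → F)
  kernel_eq : ∀ e : E,
    kernel e =
      ∑ d ∈ G.inChannels ω (G.tail e),
          coeff d e • Sum.elim (fun i : Fin ω => Pi.single (Sum.inl i) (1 : F)) kernel d
        + Pi.single (Sum.inr e) (1 : F)

namespace Code

variable [Fintype E] {G : AcyclicNetwork V E} {ω : ℕ} {F : Type*} [Field F]

/-- The decoding matrix at the node `t`: its columns are the extended global encoding kernels of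
the channels entering `t`, its rows are indexed by `In(s) ∪ E`. -/
def decodingMatrix (c : G.Code ω F) (t : V) : Matrix (Fin ω ⊕ E) {e : E // G.head e = t} F :=
  Matrix.of fun d e => c.kernel e.1 d

/-- The message space `Φ(t)`: the span of the message rows of the decoding matrix. -/
def messageSpace (c : G.Code ω F) (t : V) : Submodule F ({e : E // G.head e = t} → F) :=
  Submodule.span F (Set.range fun i : Fin ω => (c.decodingMatrix t).row (Sum.inl i))

/-- The error space `Δ(t, ρ)` of an error pattern `ρ`: the span of the rows indexed by `ρ`. -/
def errorSpace (c : G.Code ω F) (t : V) (ρ : Finset E) :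
    Submodule F ({e : E // G.head e = t} → F) :=
  Submodule.span F ((fun e : E => (c.decodingMatrix t).row (Sum.inr e)) '' (ρ : Set E))

/-- Strong regularity: `dim Φ(t) = min {ω, C_t}` at every non-source node. Strongly regular codes
are the LNEC broadcast codes. -/
def IsStronglyRegular (c : G.Code ω F) : Prop :=
  ∀ t : V, t ≠ G.source → Module.finrank F (c.messageSpace t) = min ω (G.minCut t)

/-- The minimum distance at `t`: the least cardinality of an error pattern whose error space meets
the message space nontrivially (`0` if there is no such error pattern). -/
noncomputable def minDist (c : G.Code ω F) (t : V) : ℕ :=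
  sInf {n : ℕ | ∃ ρ : Finset E, c.errorSpace t ρ ⊓ c.messageSpace t ≠ ⊥ ∧ ρ.card = n}

/-- LNEC broadcast MDS code: strongly regular, and the weakly extended Singleton bound holds with
equality at every non-source node `t`. If `C_t = 0` then `Φ(t) = 0`, so that no error pattern enters
the minimum in the definition of the distance and there is no distance to speak of. -/
def IsBroadcastMDS (c : G.Code ω F) : Prop :=
  c.IsStronglyRegular ∧
    ∀ t : V, t ≠ G.source → 1 ≤ G.minCut t →
      c.minDist t = if ω ≤ G.minCut t then (G.minCut t - ω) + 1 else 1

end Code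

section Patterns

variable [Fintype E] (G : AcyclicNetwork V E) (ω : ℕ) (F : Type*) [Field F]

/-- `ρ₁ ≺_t ρ₂`: the error space of `ρ₁` lies in that of `ρ₂` for every LNEC code. -/
def Dominated (t : V) (ρ₁ ρ₂ : Finset E) : Prop :=
  ∀ c : G.Code ω F, c.errorSpace t ρ₁ ≤ c.errorSpace t ρ₂

/-- The rank of an error pattern with respect to `t`. -/
noncomputable def patternRank (t : V) (ρ : Finset E) : ℕ :=
  sInf {n : ℕ | ∃ ρ' : Finset E, G.Dominated ω F t ρ ρ' ∧ ρ'.card = n}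

/-- `R_t(δ_t)` with `δ_t = C_t - ω`: the error patterns with `|ρ| = rank_t(ρ) = δ_t`. It is used only
for `ω ≤ C_t`. -/
def redundancyPatterns (t : V) : Set (Finset E) :=
  {ρ | ρ.card = G.minCut t - ω ∧ G.patternRank ω F t ρ = G.minCut t - ω}

end Patterns

end AcyclicNetwork

/-! Let `K` be the matrix of local coefficients. By acyclicity `1 - K` is invertible, and the
columns of its inverse are the extended kernels. A dependence `x` among the rows of a set `S` at `t`
gives `y = x (1 - K)⁻¹` vanishing on `In(t)`, with `y (1 - K) = x` vanishing off `S`. So the rows of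
`S` are independent once a suitable minor of `1 - K`, with the columns of `S` deleted, is nonzero.
As a polynomial in the coefficients this minor has degree at most one in each variable, and it is
not the zero polynomial if channel-disjoint paths lead from `S` to `t`; Hall's theorem provides
these when `S` is linked to `t`. Hence a field with more than `n` elements can meet `n` such
requirements at once (`exists_code_linearIndepOn`).

One requirement is imposed for each pattern in `R_t(δ_t)` (all messages together with the pattern)
and one for each node of `V_2` (some `C_t` messages). These sets are linked (`isLinked_of_card_le`):
a separating set either misses a message of `S`, so that its real channels form a cut, or contains
all messages of `S` and dominates the real channels of `S`.

The requirements suffice because every pattern of at most `δ_t` channels is dominated by a member of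
`R_t(δ_t)` (`exists_mem_redundancyPatterns`). The opposite bound on the distance comes from a
minimum cut, whose error space contains the message space. -/

namespace AcyclicNetwork

open Classical in
/-- The channels (imaginary ones included) entering the tail of a channel. -/
noncomputable def predecessors {V E : Type*} [Fintype E] (G : AcyclicNetwork V E) (ω : ℕ) :
    Fin ω ⊕ E → Finset (Fin ω ⊕ E) :=
  Sum.elim (fun _ => ∅) fun e => G.inChannels ω (G.tail e)

open Classical in
/-- The matrix of local encoding coefficients, with rows and columns indexed by all channels. -/
noncomputable def transfer {V E R : Type*} [Fintype E] [CommRing R] (G : AcyclicNetwork V E)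
    {ω : ℕ} (k : Fin ω ⊕ E → E → R) : Matrix (Fin ω ⊕ E) (Fin ω ⊕ E) R :=
  Matrix.of fun d =>
    Sum.elim (fun _ => 0) fun e => if d ∈ G.inChannels ω (G.tail e) then k d e else 0

open Classical in
/-- A set `S` of channels is linked to `t` if every set of channels separating it from `t` has at
least as many elements. The separating sets are given by the sets `A` of channels disjoint from
`S`: they consist of the channels outside `A` that enter `t` or the tail of a channel in `A`. -/
def IsLinked {V E : Type*} [Fintype E] (G : AcyclicNetwork V E) {ω : ℕ} (t : V)
    (S : Finset (Fin ω ⊕ E)) : Prop :=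
  ∀ A : Finset (Fin ω ⊕ E), Disjoint A S →
    S.card ≤ ((A.biUnion (G.predecessors ω) ∪ G.inChannels ω t) \ A).card

/-! ### Acyclicity as well-foundedness on channels -/

section Topology

theorem wellFounded_step {V E : Type*} [Finite V] (G : AcyclicNetwork V E) :
    WellFounded (Relation.TransGen fun i j => ∃ e : E, G.tail e = i ∧ G.head e = j) :=
  have : Std.Irrefl (Relation.TransGen fun i j => ∃ e : E, G.tail e = i ∧ G.head e = j) :=
    ⟨G.acyclic⟩
  Finite.wellFounded_of_trans_of_irrefl _

variable {V E : Type*} [Fintype E] (G : AcyclicNetwork V E) {ω : ℕ}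

@[simp] theorem inl_mem_inChannels {v : V} {i : Fin ω} :
    Sum.inl i ∈ G.inChannels ω v ↔ v = G.source := by
  simp [inChannels]

@[simp] theorem inr_mem_inChannels {v : V} {e : E} :
    Sum.inr e ∈ G.inChannels ω v ↔ G.head e = v := by
  simp [inChannels]

@[simp] theorem predecessors_inl (i : Fin ω) : G.predecessors ω (Sum.inl i) = ∅ := rfl

@[simp] theorem predecessors_inr (e : E) :
    G.predecessors ω (Sum.inr e) = G.inChannels ω (G.tail e) := rfl

theorem transfer_eq_zero {R : Type*} [CommRing R] (k : Fin ω ⊕ E → E → R) {d b : Fin ω ⊕ E}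
    (h : d ∉ G.predecessors ω b) : G.transfer k d b = 0 := by
  cases b with
  | inl i => rfl
  | inr e => exact if_neg h

theorem transfer_inr_of_mem {R : Type*} [CommRing R] (k : Fin ω ⊕ E → E → R) {d : Fin ω ⊕ E}
    {e : E} (h : d ∈ G.predecessors ω (Sum.inr e)) : G.transfer k d (Sum.inr e) = k d e :=
  if_pos h

theorem wellFounded_predecessors [Finite V] :
    WellFounded fun d b : Fin ω ⊕ E => d ∈ G.predecessors ω b := by
  have hl : ∀ i : Fin ω, Acc (fun d b : Fin ω ⊕ E => d ∈ G.predecessors ω b) (Sum.inl i) :=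
    fun i => Acc.intro _ fun d hd => by simp at hd
  have hr : ∀ v : V, ∀ e : E, G.tail e = v →
      Acc (fun d b : Fin ω ⊕ E => d ∈ G.predecessors ω b) (Sum.inr e) := by
    intro v
    induction v using G.wellFounded_step.induction with
    | _ v ih =>
      intro e he
      refine Acc.intro _ fun d hd => ?_
      cases d with
      | inl i => exact hl i
      | inr e' =>
        exact ih _ (Relation.TransGen.single ⟨e', rfl, by simpa [he] using hd⟩) e' rfl
  exact ⟨fun d => Sum.casesOn d hl fun e => hr _ e rfl⟩

theorem wellFounded_successors [Finite V] :
    WellFounded fun d b : Fin ω ⊕ E => b ∈ G.predecessors ω d := by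
  have hwf := (G.wellFounded_predecessors (ω := ω)).transGen
  have : Std.Irrefl (Function.swap
      (Relation.TransGen fun d b : Fin ω ⊕ E => d ∈ G.predecessors ω b)) :=
    ⟨fun d hd => hwf.irrefl.irrefl d hd⟩
  have : IsTrans _ (Function.swap
      (Relation.TransGen fun d b : Fin ω ⊕ E => d ∈ G.predecessors ω b)) :=
    ⟨fun _ _ _ h₁ h₂ => Relation.TransGen.trans h₂ h₁⟩
  exact Subrelation.wf (fun h => Relation.TransGen.single h)
    (Finite.wellFounded_of_trans_of_irrefl (Function.swap
      (Relation.TransGen fun d b : Fin ω ⊕ E => d ∈ G.predecessors ω b)))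

theorem notMem_predecessors_self [Finite V] (d : Fin ω ⊕ E) : d ∉ G.predecessors ω d :=
  fun h => G.wellFounded_predecessors.irrefl.irrefl d h

end Topology

/-! ### Disjoint paths from Hall's theorem -/

section Matching

variable {V E : Type*} [Fintype E] (G : AcyclicNetwork V E) {ω : ℕ}

open Classical in
/-- By Hall's theorem, a linked set of channels is the set of initial channels of a system of
channel-disjoint paths to `t`, given here by the predecessor map of the remaining channels. -/
theorem IsLinked.exists_matching {t : V} {S : Finset (Fin ω ⊕ E)} (h : G.IsLinked t S) :
    ∃ τ : {d // d ∉ S} → Fin ω ⊕ E, Function.Injective τ ∧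
      (∀ a, τ a = a ∨ τ a ∈ G.predecessors ω a) ∧
      ∀ d, d ∉ G.inChannels ω t → d ∈ Set.range τ := by
  -- The `S.card` extra slots accept only channels of `In(t)`. They make the matching a bijection,
  -- so every channel outside `In(t)` must be hit by `τ`.
  let N : {d // d ∉ S} ⊕ Fin S.card → Finset (Fin ω ⊕ E) :=
    Sum.elim (fun a => insert a.1 (G.predecessors ω a)) fun _ => G.inChannels ω t
  obtain ⟨f, hf, hfN⟩ := (Finset.all_card_le_biUnion_card_iff_exists_injective N).1 (by
    intro s
    let A : Finset (Fin ω ⊕ E) := s.toLeft.map (Function.Embedding.subtype _)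
    have hA : A.card = s.toLeft.card := Finset.card_map _
    have hAS : Disjoint A S := by
      rw [Finset.disjoint_left]
      intro d hd
      obtain ⟨a, -, rfl⟩ := Finset.mem_map.1 hd
      exact a.2
    have hAN : A ⊆ s.biUnion N := by
      intro d hd
      obtain ⟨a, ha, rfl⟩ := Finset.mem_map.1 hd
      exact Finset.mem_biUnion.2 ⟨Sum.inl a, by simpa using ha, Finset.mem_insert_self _ _⟩
    rw [← Finset.card_toLeft_add_card_toRight, ← hA]
    rcases s.toRight.eq_empty_or_nonempty with h0 | ⟨j, hj⟩
    · rw [h0, Finset.card_empty, add_zero]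
      exact Finset.card_le_card hAN
    · have hC : (A.biUnion (G.predecessors ω) ∪ G.inChannels ω t) \ A ⊆ s.biUnion N \ A := by
        refine Finset.sdiff_subset_sdiff (Finset.union_subset ?_ ?_) le_rfl
        · intro d hd
          obtain ⟨b, hb, hdb⟩ := Finset.mem_biUnion.1 hd
          obtain ⟨a, ha, rfl⟩ := Finset.mem_map.1 hb
          exact Finset.mem_biUnion.2
            ⟨Sum.inl a, by simpa using ha, Finset.mem_insert_of_mem hdb⟩
        · intro d hd
          exact Finset.mem_biUnion.2 ⟨Sum.inr j, by simpa using hj, hd⟩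
      have h₁ := (h A hAS).trans (Finset.card_le_card hC)
      have h₂ : s.toRight.card ≤ S.card := by simpa using Finset.card_le_univ s.toRight
      have h₃ := Finset.card_sdiff_add_card_eq_card hAN
      omega)
  refine ⟨fun a => f (Sum.inl a), fun a b hab => Sum.inl_injective (hf hab),
    fun a => by simpa [N] using hfN (Sum.inl a), fun d hd => ?_⟩
  have hcard : Fintype.card ({d // d ∉ S} ⊕ Fin S.card) = Fintype.card (Fin ω ⊕ E) := by
    have h₁ := Fintype.card_subtype_compl (fun d => d ∈ S)
    have h₂ : S.card ≤ Fintype.card (Fin ω ⊕ E) := Finset.card_le_univ S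
    rw [Fintype.card_coe] at h₁
    rw [Fintype.card_sum (α := {d // d ∉ S}), Fintype.card_fin, h₁]
    omega
  obtain ⟨x, rfl⟩ := ((Fintype.bijective_iff_injective_and_card f).2 ⟨hf, hcard⟩).2 d
  cases x with
  | inl a => exact ⟨a, rfl⟩
  | inr j => exact absurd (hfN (Sum.inr j)) hd

end Matching

/-! ### Nonvanishing minors of `1 - K` -/

section Minor

variable {V E : Type*} [Finite V] [Fintype E] (G : AcyclicNetwork V E) {ω : ℕ}

open Classical in
theorem det_one_sub_transfer_ne_zero {F : Type*} [Field F] (k : Fin ω ⊕ E → E → F) :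
    (1 - G.transfer k).det ≠ 0 := by
  rw [Ne, ← Matrix.exists_vecMul_eq_zero_iff]
  rintro ⟨v, hv, h⟩
  refine hv (funext fun b => ?_)
  induction b using G.wellFounded_predecessors.induction with
  | _ b ih =>
    have hb := congrFun h b
    rw [Matrix.vecMul_sub, Matrix.vecMul_one, Pi.sub_apply, Pi.zero_apply, sub_eq_zero] at hb
    rw [hb, Pi.zero_apply]
    refine Finset.sum_eq_zero fun d _ => ?_
    by_cases hd : d ∈ G.predecessors ω b
    · rw [ih d hd, Pi.zero_apply, zero_mul]
    · exact mul_eq_zero_of_right _ (G.transfer_eq_zero k hd)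

open Classical in
/-- The minor of `1 - transfer k` given by a system of channel-disjoint paths does not vanish when
`k` is the indicator function of the paths. -/
theorem exists_det_submatrix_ne_zero {F : Type*} [Field F] {S : Finset (Fin ω ⊕ E)}
    {τ : {d // d ∉ S} → Fin ω ⊕ E} (hτ : Function.Injective τ)
    (hτS : ∀ a, τ a = a ∨ τ a ∈ G.predecessors ω a) :
    ∃ k : Fin ω ⊕ E → E → F,
      ((1 - G.transfer k).submatrix τ (Subtype.val : {d // d ∉ S} → Fin ω ⊕ E)).det ≠ 0 := by
  let k : Fin ω ⊕ E → E → F := fun d e => if ∃ h : Sum.inr e ∉ S, τ ⟨_, h⟩ = d then 1 else 0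
  -- By injectivity of `τ`, row `τ a` has off the diagonal at most an entry `1`, in column `τ a`.
  -- That column precedes `a`, so the minor is triangular with diagonal entries `±1`.
  have hk : ∀ a b : {d // d ∉ S}, b ≠ a → G.transfer k (τ a) b = 0 := by
    rintro a ⟨b, hb⟩ hab
    by_cases hp : τ a ∈ G.predecessors ω b
    · cases b with
      | inl i => simp at hp
      | inr e =>
        rw [transfer_inr_of_mem _ _ hp]
        exact if_neg fun ⟨_, h⟩ => hab (hτ h)
    · exact G.transfer_eq_zero k hp
  refine ⟨k, ?_⟩
  rw [Ne, ← Matrix.exists_mulVec_eq_zero_iff]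
  rintro ⟨y, hy, h⟩
  refine hy (funext fun a => ?_)
  induction a using (InvImage.wf Subtype.val (G.wellFounded_predecessors (ω := ω))).induction with
  | _ a ih =>
    have ha := congrFun h a
    rw [Matrix.mulVec, dotProduct, Finset.sum_eq_single a] at ha
    · rw [Matrix.submatrix_apply, Matrix.sub_apply, Pi.zero_apply, mul_eq_zero] at ha
      refine ha.resolve_left ?_
      rcases hτS a with h₁ | h₁
      · rw [h₁, Matrix.one_apply_eq, G.transfer_eq_zero k (G.notMem_predecessors_self _), sub_zero]
        exact one_ne_zero
      · have h₂ : τ a ≠ a := fun h₂ => G.notMem_predecessors_self _ (h₂ ▸ h₁)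
        rw [Matrix.one_apply_ne h₂, zero_sub, neg_eq_zero]
        obtain ⟨a | e, hS⟩ := a
        · simp at h₁
        · rw [transfer_inr_of_mem _ _ h₁]
          simp [k, hS]
    · intro b _ hb
      rw [Matrix.submatrix_apply, Matrix.sub_apply, hk a b hb, sub_zero]
      by_cases h₁ : τ a = b
      · rw [ih b ((h₁ ▸ hτS a).resolve_left fun h => hb (Subtype.ext h)), Pi.zero_apply, mul_zero]
      · rw [Matrix.one_apply_ne h₁, zero_mul]
    · exact fun h => absurd (Finset.mem_univ a) h

end Minor

/-! ### The minor as a polynomial in the coefficients -/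

section Polynomial

variable {V E : Type*} [Fintype E] (G : AcyclicNetwork V E) {ω : ℕ}

open Classical in
theorem degreeOf_det_submatrix_le {F : Type*} [Field F] {S : Finset (Fin ω ⊕ E)}
    (τ : {d // d ∉ S} → Fin ω ⊕ E) (p : (Fin ω ⊕ E) × E) :
    MvPolynomial.degreeOf p
      ((1 - G.transfer fun d e => (MvPolynomial.X (d, e) : MvPolynomial ((Fin ω ⊕ E) × E) F)).submatrix
        τ (Subtype.val : {d // d ∉ S} → Fin ω ⊕ E)).det ≤ 1 := by
  -- The variable `(d, e)` occurs only in column `e`, and each term of the determinant takes one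
  -- entry per column.
  have hentry : ∀ d b : Fin ω ⊕ E, MvPolynomial.degreeOf p
      ((1 - G.transfer fun d e => (MvPolynomial.X (d, e) : MvPolynomial ((Fin ω ⊕ E) × E) F)) d b) ≤
        if b = Sum.inr p.2 then 1 else 0 := by
    intro d b
    rw [Matrix.sub_apply]
    refine (MvPolynomial.degreeOf_sub_le _ _ _).trans (max_le ?_ ?_)
    · rw [Matrix.one_apply]
      split_ifs <;> simp
    · by_cases hp : d ∈ G.predecessors ω b
      · cases b with
        | inl i => simp at hp
        | inr e =>
          rw [transfer_inr_of_mem _ _ hp, MvPolynomial.degreeOf_X]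
          by_cases h : p = (d, e)
          · simp [h]
          · simp [h]
      · simp [G.transfer_eq_zero _ hp]
  rw [Matrix.det_apply]
  refine (MvPolynomial.degreeOf_sum_le _ _ _).trans (Finset.sup_le fun σ _ => ?_)
  have hsign : ∀ q : MvPolynomial ((Fin ω ⊕ E) × E) F,
      MvPolynomial.degreeOf p (Equiv.Perm.sign σ • q) ≤ MvPolynomial.degreeOf p q := by
    intro q
    rcases Int.units_eq_one_or (Equiv.Perm.sign σ) with h | h <;> simp [h]
  refine (hsign _).trans ((MvPolynomial.degreeOf_prod_le _ _ _).trans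
    ((Finset.sum_le_sum fun b _ => hentry _ _).trans ?_))
  rw [Finset.sum_boole, Nat.cast_id, Finset.card_le_one]
  intro a ha b hb
  simp only [Finset.mem_filter, Finset.mem_univ, true_and] at ha hb
  exact Subtype.ext (ha.trans hb.symm)

open Classical in
theorem eval_det_submatrix {F : Type*} [Field F] {S : Finset (Fin ω ⊕ E)}
    (τ : {d // d ∉ S} → Fin ω ⊕ E) (x : (Fin ω ⊕ E) × E → F) :
    MvPolynomial.eval x
      ((1 - G.transfer fun d e => (MvPolynomial.X (d, e) : MvPolynomial ((Fin ω ⊕ E) × E) F)).submatrix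
        τ (Subtype.val : {d // d ∉ S} → Fin ω ⊕ E)).det =
      ((1 - G.transfer fun d e => x (d, e)).submatrix τ
        (Subtype.val : {d // d ∉ S} → Fin ω ⊕ E)).det := by
  rw [RingHom.map_det]
  congr 1
  ext a ⟨b, hb⟩
  simp only [RingHom.mapMatrix_apply, Matrix.map_apply, Matrix.submatrix_apply, Matrix.sub_apply,
    map_sub, Matrix.one_apply]
  congr 1
  · split_ifs <;> simp
  · cases b with
    | inl i => simp [transfer]
    | inr e =>
      simp only [transfer, Matrix.of_apply, Sum.elim_inr]
      split_ifs <;> simp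

end Polynomial

/-! ### Kernels as the inverse of `1 - K` -/

namespace Code

section Kernel

variable {V E : Type*} [Fintype E] {G : AcyclicNetwork V E} {ω : ℕ} {F : Type*} [Field F]

open Classical in
/-- The square matrix whose columns are the extended global encoding kernels of all channels, the
imaginary ones included. -/
noncomputable def kernelMatrix (c : G.Code ω F) :
    Matrix (Fin ω ⊕ E) (Fin ω ⊕ E) F :=
  Matrix.of fun d e => Sum.elim (fun i : Fin ω => Pi.single (Sum.inl i) (1 : F)) c.kernel e d

open Classical in
theorem kernelMatrix_mul (c : G.Code ω F) : c.kernelMatrix * (1 - G.transfer c.coeff) = 1 := by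
  rw [mul_sub, mul_one, sub_eq_iff_eq_add]
  ext d b
  rw [Matrix.add_apply, Matrix.mul_apply]
  cases b with
  | inl i =>
    simp [kernelMatrix, transfer, Matrix.one_apply, Pi.single_apply]
  | inr e =>
    have h := congrFun (c.kernel_eq e) d
    simp only [Pi.add_apply, Finset.sum_apply, Pi.smul_apply, smul_eq_mul] at h
    simp only [kernelMatrix, transfer, Matrix.of_apply, Sum.elim_inr, mul_ite, mul_zero,
      Finset.sum_ite_mem, Finset.univ_inter, Matrix.one_apply]
    rw [h, add_comm, Pi.single_apply]
    simp only [mul_comm]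

open Classical in
theorem mul_kernelMatrix (c : G.Code ω F) : (1 - G.transfer c.coeff) * c.kernelMatrix = 1 :=
  mul_eq_one_comm.1 c.kernelMatrix_mul

open Classical in
/-- The code with given local encoding coefficients. -/
noncomputable def ofCoeff [Finite V] (k : Fin ω ⊕ E → E → F) : G.Code ω F where
  coeff := k
  kernel e d := (1 - G.transfer k)⁻¹ d (Sum.inr e)
  kernel_eq e := by
    have h₁ : (1 - G.transfer k)⁻¹ = 1 + (1 - G.transfer k)⁻¹ * G.transfer k := by
      have h := Matrix.nonsing_inv_mul (1 - G.transfer k)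
        (isUnit_iff_ne_zero.2 (G.det_one_sub_transfer_ne_zero k))
      rwa [mul_sub, mul_one, sub_eq_iff_eq_add] at h
    have h₂ : ∀ d b, (1 - G.transfer k)⁻¹ d b = (1 : Matrix _ _ F) d b +
        ∑ x, (1 - G.transfer k)⁻¹ d x * G.transfer k x b := fun d b => by
      conv_lhs => rw [h₁]
      rw [Matrix.add_apply, Matrix.mul_apply]
    funext d
    simp only [Pi.add_apply, Finset.sum_apply, Pi.smul_apply, smul_eq_mul]
    rw [h₂, add_comm, Matrix.one_apply, Pi.single_apply]
    congr 1
    simp only [transfer, Matrix.of_apply, Sum.elim_inr, mul_ite, mul_zero, Finset.sum_ite_mem,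
      Finset.univ_inter]
    refine Finset.sum_congr rfl fun x _ => ?_
    rw [mul_comm]
    congr 1
    cases x with
    | inl i =>
      have h := h₂ d (Sum.inl i)
      simpa [transfer, Matrix.one_apply, Pi.single_apply] using h
    | inr e' => rfl

-- Reading the inverse relation from the other side expands a row over the successors of its
-- channel, whereas `kernel_eq` expands a column over predecessors.
open Classical in
theorem decodingMatrix_row_eq (c : G.Code ω F) (t : V) (d : Fin ω ⊕ E) :
    (c.decodingMatrix t).row d = (fun e => if d = Sum.inr e.1 then 1 else 0) +
      ∑ x, G.transfer c.coeff d x • (c.decodingMatrix t).row x := by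
  have h := c.mul_kernelMatrix
  rw [sub_mul, one_mul, sub_eq_iff_eq_add] at h
  funext e
  have he := congrFun (congrFun h d) (Sum.inr e.1)
  rw [Matrix.add_apply, Matrix.mul_apply, Matrix.one_apply] at he
  simp only [Pi.add_apply, Finset.sum_apply, Pi.smul_apply, smul_eq_mul]
  exact he

/-- The rows of a set `C` of channels span the row of every channel all of whose paths to `t` pass
through `C`. -/
theorem row_mem_span [Finite V] (c : G.Code ω F) {t : V} {C P : Set (Fin ω ⊕ E)}
    (h : ∀ d ∈ P, d ∈ C ∨
      d ∉ G.inChannels ω t ∧ ∀ e, d ∈ G.predecessors ω (Sum.inr e) → Sum.inr e ∈ P)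
    {d : Fin ω ⊕ E} (hd : d ∈ P) :
    (c.decodingMatrix t).row d ∈ Submodule.span F ((c.decodingMatrix t).row '' C) := by
  classical
  induction d using G.wellFounded_successors.induction with
  | _ d ih =>
    rcases h d hd with hC | ⟨ht, hsucc⟩
    · exact Submodule.subset_span ⟨d, hC, rfl⟩
    · rw [decodingMatrix_row_eq]
      have h0 : (fun e : {e : E // G.head e = t} => if d = Sum.inr e.1 then (1 : F) else 0) = 0 := by
        funext e
        refine if_neg fun hde => ht ?_
        rw [hde, inr_mem_inChannels]
        exact e.2
      rw [h0, zero_add]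
      refine Submodule.sum_mem _ fun x _ => ?_
      by_cases hx : d ∈ G.predecessors ω x
      · cases x with
        | inl i => simp at hx
        | inr e => exact Submodule.smul_mem _ _ (ih _ hx (hsucc e hx))
      · rw [G.transfer_eq_zero _ hx, zero_smul]
        exact Submodule.zero_mem _

theorem errorSpace_eq (c : G.Code ω F) (t : V) (ρ : Finset E) :
    c.errorSpace t ρ =
      Submodule.span F ((c.decodingMatrix t).row '' (Sum.inr '' (ρ : Set E))) := by
  rw [errorSpace, Set.image_image]

open Classical in
theorem linearIndepOn_row_of_det_ne_zero (c : G.Code ω F) {t : V} (ht : t ≠ G.source)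
    {S : Finset (Fin ω ⊕ E)} (τ : {d // d ∉ S} → Fin ω ⊕ E)
    (hτt : ∀ d, d ∉ G.inChannels ω t → d ∈ Set.range τ) (hτ : Function.Injective τ)
    (hdet : ((1 - G.transfer c.coeff).submatrix τ
      (Subtype.val : {d // d ∉ S} → Fin ω ⊕ E)).det ≠ 0) :
    LinearIndepOn F (c.decodingMatrix t).row (S : Set (Fin ω ⊕ E)) := by
  rw [linearIndepOn_finset_iff]
  intro f hf
  let x : Fin ω ⊕ E → F := fun d => if d ∈ S then f d else 0
  let y : Fin ω ⊕ E → F := Matrix.vecMul x c.kernelMatrix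
  have hyx : Matrix.vecMul y (1 - G.transfer c.coeff) = x := by
    rw [Matrix.vecMul_vecMul, kernelMatrix_mul, Matrix.vecMul_one]
  have hyt : ∀ d ∈ G.inChannels ω t, y d = 0 := by
    intro d hd
    cases d with
    | inl i => exact absurd (by simpa using hd) ht
    | inr e =>
      have h := congrFun hf ⟨e, by simpa using hd⟩
      simp only [y, x, Matrix.vecMul, dotProduct, ite_mul, zero_mul, Finset.sum_ite_mem,
        Finset.univ_inter]
      rw [Finset.sum_apply] at h
      exact h
  have hyτ : (fun a => y (τ a)) = 0 := by
    refine Matrix.eq_zero_of_vecMul_eq_zero hdet (funext fun b => ?_)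
    have hb := congrFun hyx b.1
    rw [show x b.1 = 0 from if_neg b.2] at hb
    rw [Pi.zero_apply, ← hb]
    exact Fintype.sum_of_injective τ hτ _ _
      (fun d hd => mul_eq_zero_of_left (hyt d (not_not.1 (mt (hτt d) hd))) _) fun _ => rfl
  have hy : y = 0 := by
    funext d
    by_cases hd : d ∈ G.inChannels ω t
    · exact hyt d hd
    · obtain ⟨a, rfl⟩ := hτt d hd
      exact congrFun hyτ a
  intro d hd
  rw [hy, Matrix.zero_vecMul] at hyx
  simpa [x, hd] using (congrFun hyx d).symm

end Kernel

end Code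

/-! ### Meeting many independence requirements at once -/

section Existence

variable {V E : Type*} [Fintype E] (G : AcyclicNetwork V E) {ω : ℕ}

theorem IsLinked.exists_polynomial [Finite V] (F : Type*) [Field F] {t : V} (ht : t ≠ G.source)
    {S : Finset (Fin ω ⊕ E)} (h : G.IsLinked t S) :
    ∃ P : MvPolynomial ((Fin ω ⊕ E) × E) F, P ≠ 0 ∧ (∀ p, P.degreeOf p ≤ 1) ∧
      ∀ c : G.Code ω F, MvPolynomial.eval (fun p => c.coeff p.1 p.2) P ≠ 0 →
        LinearIndepOn F (c.decodingMatrix t).row (S : Set (Fin ω ⊕ E)) := by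
  classical
  obtain ⟨τ, hτ, hτS, hτt⟩ := h.exists_matching
  refine ⟨_, ?_, G.degreeOf_det_submatrix_le τ, fun c hc => ?_⟩
  · obtain ⟨k, hk⟩ := G.exists_det_submatrix_ne_zero (F := F) hτ hτS
    intro h0
    refine hk ?_
    have := G.eval_det_submatrix (F := F) τ fun p => k p.1 p.2
    rw [h0, map_zero] at this
    exact this.symm
  · rw [eval_det_submatrix] at hc
    exact c.linearIndepOn_row_of_det_ne_zero ht τ hτt hτ hc

/-- Over a field with more than `Q.card` elements, `Q.card` independence requirements can be met
at once. -/
theorem exists_code_linearIndepOn [Finite V] (F : Type*) [Field F] (Q : Finset (V × Finset (Fin ω ⊕ E)))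
    (hF : (Q.card : ℕ∞) < ENat.card F)
    (hQ : ∀ q ∈ Q, q.1 ≠ G.source ∧ G.IsLinked q.1 q.2) :
    ∃ c : G.Code ω F, ∀ q ∈ Q,
      LinearIndepOn F (c.decodingMatrix q.1).row (q.2 : Set (Fin ω ⊕ E)) := by
  classical
  choose! P hP0 hPdeg hP using fun q (hq : q ∈ Q) => (hQ q hq).2.exists_polynomial G F (hQ q hq).1
  -- `F` may be infinite. A grid of side `Q.card + 1` detects a nonzero polynomial of degree at most
  -- `Q.card` in each variable.
  obtain ⟨T, -, hT⟩ : ∃ T : Set F, T ⊆ Set.univ ∧ T.encard = (Q.card + 1 : ℕ) :=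
    Set.exists_subset_encard_eq (by
      rw [Set.encard_univ]
      exact_mod_cast Order.add_one_le_of_lt hF)
  have hTfin : T.Finite := Set.finite_of_encard_eq_coe hT
  have hTcard : hTfin.toFinset.card = Q.card + 1 := by
    rw [hTfin.encard_eq_coe_toFinset_card] at hT
    exact_mod_cast hT
  obtain ⟨x, hx⟩ : ∃ x : (Fin ω ⊕ E) × E → F, MvPolynomial.eval x (∏ q ∈ Q, P q) ≠ 0 := by
    by_contra! h
    refine Finset.prod_ne_zero_iff.2 hP0
      (MvPolynomial.eq_zero_of_eval_zero_at_prod_finset _ (fun _ => hTfin.toFinset)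
        (fun p => ?_) fun x _ => h x)
    rw [hTcard, Nat.lt_succ_iff]
    refine (MvPolynomial.degreeOf_prod_le _ _ _).trans
      ((Finset.sum_le_sum fun q hq => hPdeg q hq p).trans ?_)
    simp
  rw [map_prod, Finset.prod_ne_zero_iff] at hx
  exact ⟨Code.ofCoeff fun d e => x (d, e), fun q hq => hP q hq _ (hx q hq)⟩

theorem IsLinked.exists_code [Finite V] (F : Type*) [Field F] {t : V} (ht : t ≠ G.source)
    {S : Finset (Fin ω ⊕ E)} (h : G.IsLinked t S) :
    ∃ c : G.Code ω F, LinearIndepOn F (c.decodingMatrix t).row (S : Set (Fin ω ⊕ E)) := by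
  obtain ⟨c, hc⟩ := G.exists_code_linearIndepOn F {(t, S)}
    (by simp)
    (by simpa using ⟨ht, h⟩)
  exact ⟨c, hc _ (Finset.mem_singleton_self _)⟩

end Existence

/-! ### Cuts and separating sets -/

section Cuts

variable {V E : Type*} (G : AcyclicNetwork V E) {ω : ℕ}

theorem minCut_le {t : V} {B : Finset E} (h : G.IsCut t B) : G.minCut t ≤ B.card :=
  Nat.sInf_le ⟨B, h, rfl⟩

theorem ne_source_of_isCut {t : V} {B : Finset E} (h : G.IsCut t B) : t ≠ G.source := by
  rintro rfl
  exact h .refl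

variable [Fintype E]

theorem exists_isCut_card_eq_minCut {t : V} (ht : t ≠ G.source) :
    ∃ B : Finset E, G.IsCut t B ∧ B.card = G.minCut t := by
  refine Nat.sInf_mem (s := {n : ℕ | ∃ B : Finset E, G.IsCut t B ∧ B.card = n})
    ⟨_, Finset.univ, fun h => ?_, rfl⟩
  rcases h.cases_head with h | ⟨v, ⟨e, he, -⟩, -⟩
  · exact ht h.symm
  · exact he (Finset.mem_univ e)

open Classical in
theorem minCut_le_card_inChannels (t : V) (ht : t ≠ G.source) :
    G.minCut t ≤ Fintype.card {e : E // G.head e = t} := by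
  rw [Fintype.card_subtype]
  refine G.minCut_le fun h => ?_
  rcases h.cases_tail with h | ⟨v, -, ⟨e, he, -, heq⟩⟩
  · exact ht h
  · exact he (by simpa using heq)

open Classical in
theorem isCut_of_inl_notMem {t : V} (ht : t ≠ G.source) {A : Finset (Fin ω ⊕ E)} {i : Fin ω}
    (hA : Sum.inl i ∉ A)
    (hi : Sum.inl i ∉ (A.biUnion (G.predecessors ω) ∪ G.inChannels ω t) \ A) :
    G.IsCut t ((A.biUnion (G.predecessors ω) ∪ G.inChannels ω t) \ A).toRight := by
  have key : ∀ d, d ∉ A → d ∉ (A.biUnion (G.predecessors ω) ∪ G.inChannels ω t) \ A →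
      d ∉ G.inChannels ω t ∧ ∀ e, d ∈ G.predecessors ω (Sum.inr e) → Sum.inr e ∉ A := by
    intro d hdA hd
    simp only [Finset.mem_sdiff, Finset.mem_union, Finset.mem_biUnion, not_and_not_right] at hd
    exact ⟨fun h => hdA (hd (Or.inr h)), fun e he heA => hdA (hd (Or.inl ⟨_, heA, he⟩))⟩
  -- Invariant along a path avoiding the separating set: the node is not `t` and no channel leaving
  -- it lies in `A`.
  have inv : ∀ v, Relation.ReflTransGen (fun i j => ∃ e : E,
      e ∉ ((A.biUnion (G.predecessors ω) ∪ G.inChannels ω t) \ A).toRight ∧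
        G.tail e = i ∧ G.head e = j) G.source v →
      v ≠ t ∧ ∀ e, G.tail e = v → Sum.inr e ∉ A := by
    intro v hv
    induction hv with
    | refl => exact ⟨ht.symm, fun e he => (key _ hA hi).2 e (by simp [he])⟩
    | tail _ hstep ih =>
      obtain ⟨e, heB, rfl, rfl⟩ := hstep
      have h := key _ (ih.2 e rfl) (by simpa using heB)
      exact ⟨by simpa using h.1, fun e' he' => h.2 e' (by simp [he'])⟩
  exact fun h => (inv t h).1 rfl

end Cuts

theorem card_le_finrank_of_linearIndepOn_image {K M ι κ : Type*} [Field K] [AddCommGroup M]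
    [Module K M] [Module.Finite K M] {v : ι → M} {f : κ → ι} (hf : Function.Injective f)
    {s : Finset κ} (h : LinearIndepOn K v (f '' (s : Set κ))) {W : Submodule K M}
    (hW : ∀ a ∈ s, v (f a) ∈ W) : s.card ≤ Module.finrank K W := by
  have h₁ : LinearIndependent K fun x : f '' (s : Set κ) => v x := h
  have h₂ := h₁.comp (fun a : s => ⟨f a, a, a.2, rfl⟩)
    fun a b hab => Subtype.ext (hf (congrArg Subtype.val hab))
  have h₃ : LinearIndependent K fun a : s => (⟨v (f a), hW a a.2⟩ : W) :=
    LinearIndependent.of_comp W.subtype h₂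
  simpa using h₃.fintype_card_le_finrank

/-! ### Domination and rank of error patterns -/

section Patterns

variable {V E : Type*} [Fintype E] (G : AcyclicNetwork V E) {ω : ℕ} {F : Type*} [Field F]

theorem Code.row_inl_mem_errorSpace [Finite V] {G : AcyclicNetwork V E} (c : G.Code ω F) {t : V}
    {B : Finset E} (hB : G.IsCut t B) (i : Fin ω) :
    (c.decodingMatrix t).row (Sum.inl i) ∈ c.errorSpace t B := by
  rw [Code.errorSpace_eq]
  -- `P` consists of the message channels and the channels whose tail is reachable without using
  -- `B`.
  refine c.row_mem_span (P := {d | ∀ e, d = Sum.inr e →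
    Relation.ReflTransGen (fun i j => ∃ e : E, e ∉ B ∧ G.tail e = i ∧ G.head e = j)
      G.source (G.tail e)}) ?_ (fun e he => by simp at he)
  rintro (i | e) hd
  · refine Or.inr ⟨by simpa using G.ne_source_of_isCut hB, ?_⟩
    rintro e he _ ⟨rfl⟩
    rw [predecessors_inr, inl_mem_inChannels] at he
    rw [he]
  · by_cases he : e ∈ B
    · exact Or.inl ⟨e, he, rfl⟩
    · have hreach := (hd e rfl).tail ⟨e, he, rfl, rfl⟩
      refine Or.inr ⟨fun h => hB ?_, ?_⟩
      · rw [inr_mem_inChannels] at h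
        rwa [h] at hreach
      · rintro e' he' _ ⟨rfl⟩
        rw [predecessors_inr, inr_mem_inChannels] at he'
        rwa [he'] at hreach

theorem Code.messageSpace_le_errorSpace [Finite V] {G : AcyclicNetwork V E} (c : G.Code ω F) {t : V}
    {B : Finset E} (hB : G.IsCut t B) : c.messageSpace t ≤ c.errorSpace t B :=
  Submodule.span_le.2 (Set.range_subset_iff.2 (c.row_inl_mem_errorSpace hB))

theorem Code.finrank_errorSpace_le {G : AcyclicNetwork V E} (c : G.Code ω F) (t : V)
    (ρ : Finset E) : Module.finrank F (c.errorSpace t ρ) ≤ ρ.card := by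
  classical
  rw [Code.errorSpace, ← Finset.coe_image]
  exact (finrank_span_finset_le_card _).trans Finset.card_image_le

theorem Code.finrank_messageSpace_le_minCut [Finite V] {G : AcyclicNetwork V E} (c : G.Code ω F) {t : V}
    (ht : t ≠ G.source) : Module.finrank F (c.messageSpace t) ≤ G.minCut t := by
  obtain ⟨B, hB, hcard⟩ := G.exists_isCut_card_eq_minCut ht
  rw [← hcard]
  exact (Submodule.finrank_mono (c.messageSpace_le_errorSpace hB)).trans
    (c.finrank_errorSpace_le t B)

theorem patternRank_le {t : V} {ρ ρ' : Finset E} (h : G.Dominated ω F t ρ ρ') :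
    G.patternRank ω F t ρ ≤ ρ'.card :=
  Nat.sInf_le ⟨ρ', h, rfl⟩

variable (ω F) in
theorem exists_dominated_card_eq_patternRank (t : V) (ρ : Finset E) :
    ∃ ρ' : Finset E, G.Dominated ω F t ρ ρ' ∧ ρ'.card = G.patternRank ω F t ρ :=
  Nat.sInf_mem (s := {n : ℕ | ∃ ρ' : Finset E, G.Dominated ω F t ρ ρ' ∧ ρ'.card = n})
    ⟨_, ρ, fun _ => le_rfl, rfl⟩

/-- Independence in a single code certifies full rank, since domination must hold in every code. -/
theorem card_le_patternRank [Finite V] {t : V} {ρ : Finset E} (c : G.Code ω F)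
    (h : LinearIndepOn F (c.decodingMatrix t).row (Sum.inr '' (ρ : Set E))) :
    ρ.card ≤ G.patternRank ω F t ρ := by
  obtain ⟨ρ', hρ', hcard⟩ := G.exists_dominated_card_eq_patternRank ω F t ρ
  rw [← hcard]
  have h' : ρ.card ≤ Module.finrank F (c.errorSpace t ρ) :=
    card_le_finrank_of_linearIndepOn_image Sum.inr_injective h fun e he =>
      Submodule.subset_span ⟨e, he, rfl⟩
  exact h'.trans ((Submodule.finrank_mono (hρ' c)).trans
    (c.finrank_errorSpace_le t ρ'))

open Classical in
theorem isLinked_of_card_le [Finite V] {t : V} (ht : t ≠ G.source) {S : Finset (Fin ω ⊕ E)}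
    (hS : S.card ≤ G.minCut t) (hSF : S.toRight.card ≤ G.patternRank ω F t S.toRight) :
    G.IsLinked t S := by
  intro A hAS
  set C := (A.biUnion (G.predecessors ω) ∪ G.inChannels ω t) \ A
  have hCcard := Finset.card_toLeft_add_card_toRight (u := C)
  have hScard := Finset.card_toLeft_add_card_toRight (u := S)
  by_cases hi : ∃ i ∈ S.toLeft, Sum.inl i ∉ C
  · obtain ⟨i, hiS, hiC⟩ := hi
    have : G.minCut t ≤ C.toRight.card := G.minCut_le (G.isCut_of_inl_notMem ht
      (Finset.disjoint_right.1 hAS (Finset.mem_toLeft.1 hiS)) hiC)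
    omega
  · push Not at hi
    have h₁ : S.toLeft.card ≤ C.toLeft.card :=
      Finset.card_le_card fun i hi' => Finset.mem_toLeft.2 (hi i hi')
    have h₂ : G.Dominated ω F t S.toRight C.toRight := by
      intro c
      rw [Code.errorSpace_eq c t C.toRight, Code.errorSpace, Submodule.span_le]
      rintro _ ⟨e, he, rfl⟩
      refine c.row_mem_span (P := {d | d ∉ A ∧ d.isRight}) ?_ ?_
      · rintro (i | e) ⟨hdA, hr⟩
        · simp at hr
        · by_cases heC : Sum.inr e ∈ C
          · exact Or.inl ⟨e, by simpa using heC, rfl⟩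
          · refine Or.inr ?_
            simp only [C, Finset.mem_sdiff, Finset.mem_union, Finset.mem_biUnion,
              not_and_not_right] at heC
            exact ⟨fun h => hdA (heC (Or.inr h)),
              fun e' he' => ⟨fun heA => hdA (heC (Or.inl ⟨_, heA, he'⟩)), rfl⟩⟩
      · exact ⟨Finset.disjoint_right.1 hAS (by simpa using he), rfl⟩
    have := G.patternRank_le h₂
    omega

-- In a code where the rows of `ρ` are independent, the error rows span the whole space, of
-- dimension `|In(t)| ≥ C_t > |ρ|`. Some error row therefore lies outside the span of `ρ`.
open Classical in
theorem exists_insert_card_le_patternRank [Finite V] {t : V} (ht : t ≠ G.source)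
    {ρ : Finset E} (hρ : ρ.card ≤ G.patternRank ω F t ρ) (hlt : ρ.card < G.minCut t) :
    ∃ e ∉ ρ, (insert e ρ).card ≤ G.patternRank ω F t (insert e ρ) := by
  obtain ⟨c, hc⟩ := IsLinked.exists_code G F ht (G.isLinked_of_card_le (ω := ω) (F := F) ht
    (S := (∅ : Finset (Fin ω)).disjSum ρ) (by simpa using hlt.le)
    (by rwa [Finset.toRight_disjSum]))
  rw [Finset.empty_disjSum, Finset.coe_map] at hc
  change LinearIndepOn F _ (Sum.inr '' (ρ : Set E)) at hc
  have key : ∃ e, (c.decodingMatrix t).row (Sum.inr e) ∉ c.errorSpace t ρ := by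
    by_contra! h
    have htop : c.errorSpace t ρ = ⊤ := by
      rw [eq_top_iff, ← (Pi.basisFun F {e : E // G.head e = t}).span_eq, Submodule.span_le]
      rintro _ ⟨e, rfl⟩
      have hrow := c.decodingMatrix_row_eq t (Sum.inr e.1)
      -- Each unit vector is an error row minus a combination of error rows; message rows do not
      -- enter, as no channel precedes a message channel.
      rw [← sub_eq_iff_eq_add] at hrow
      rw [SetLike.mem_coe, ← hrow.trans (show _ = Pi.basisFun F {e : E // G.head e = t} e from
        funext fun e' => by
          rw [Pi.basisFun_apply, Pi.single_apply]
          simp only [Sum.inr.injEq, Subtype.ext_iff, eq_comm])]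
      refine Submodule.sub_mem _ (h _) (Submodule.sum_mem _ fun x _ => ?_)
      cases x with
      | inl i =>
        rw [G.transfer_eq_zero _ (by simp), zero_smul]
        exact Submodule.zero_mem _
      | inr e' => exact Submodule.smul_mem _ _ (h e')
    have h₁ := c.finrank_errorSpace_le t ρ
    rw [htop, finrank_top, Module.finrank_fintype_fun_eq_card] at h₁
    have h₂ := G.minCut_le_card_inChannels t ht
    omega
  obtain ⟨e, he⟩ := key
  refine ⟨e, fun h => he (Submodule.subset_span ⟨e, h, rfl⟩), G.card_le_patternRank c ?_⟩
  rw [Finset.coe_insert, Set.image_insert_eq]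
  rw [Code.errorSpace_eq] at he
  exact hc.insert he

open Classical in
theorem exists_superset_card_le_patternRank [Finite V] {t : V} (ht : t ≠ G.source) {ρ : Finset E}
    (hρ : ρ.card ≤ G.patternRank ω F t ρ) {n : ℕ} (hn : ρ.card ≤ n) (hnC : n ≤ G.minCut t) :
    ∃ ρ', ρ ⊆ ρ' ∧ ρ'.card = n ∧ n ≤ G.patternRank ω F t ρ' := by
  induction n, hn using Nat.le_induction with
  | base => exact ⟨ρ, le_rfl, rfl, hρ⟩
  | succ n hn ih =>
    obtain ⟨ρ', hsub, hcard, hrank⟩ := ih (by omega)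
    obtain ⟨e, he, h⟩ := G.exists_insert_card_le_patternRank (F := F) ht
      (hcard.le.trans hrank) (by omega)
    have hcard' : (insert e ρ').card = n + 1 := by rw [Finset.card_insert_of_notMem he, hcard]
    exact ⟨_, hsub.trans (Finset.subset_insert _ _), hcard', hcard' ▸ h⟩

/-- Every error pattern of at most `C_t - ω` channels is dominated by a pattern of full rank with
exactly that many channels. -/
theorem exists_mem_redundancyPatterns [Finite V] {t : V} (ht : t ≠ G.source) {ρ : Finset E}
    (hρ : ρ.card ≤ G.minCut t - ω) :
    ∃ ρ' ∈ G.redundancyPatterns ω F t, G.Dominated ω F t ρ ρ' := by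
  obtain ⟨ρ₁, hdom, hcard⟩ := G.exists_dominated_card_eq_patternRank ω F t ρ
  -- Domination is transitive, so a smallest dominating pattern has full rank itself.
  have hρ₁ : ρ₁.card ≤ G.patternRank ω F t ρ₁ := by
    obtain ⟨ρ₂, hdom₂, hcard₂⟩ := G.exists_dominated_card_eq_patternRank ω F t ρ₁
    rw [hcard, ← hcard₂]
    exact G.patternRank_le fun c => (hdom c).trans (hdom₂ c)
  have hle : ρ₁.card ≤ G.minCut t - ω := by
    rw [hcard]
    exact (G.patternRank_le fun _ => le_rfl).trans hρ
  obtain ⟨ρ', hsub, hcard', hrank⟩ :=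
    G.exists_superset_card_le_patternRank ht hρ₁ hle (Nat.sub_le _ _)
  refine ⟨ρ', ⟨hcard', le_antisymm ?_ hrank⟩, fun c => (hdom c).trans ?_⟩
  · exact (G.patternRank_le fun _ => le_rfl).trans hcard'.le
  · exact Submodule.span_mono (Set.image_mono (by exact_mod_cast hsub))

end Patterns

/-! ### Minimum distance -/

namespace Code

variable {V E : Type*} [Fintype E] {G : AcyclicNetwork V E} {ω : ℕ} {F : Type*} [Field F]

/-- The Singleton bound. -/
theorem exists_errorSpace_inf_messageSpace_ne_bot [Finite V] (c : G.Code ω F) (hω : 1 ≤ ω) {t : V}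
    (ht : t ≠ G.source) (hC : ω ≤ G.minCut t)
    (hdim : Module.finrank F (c.messageSpace t) = ω) :
    ∃ ρ : Finset E, c.errorSpace t ρ ⊓ c.messageSpace t ≠ ⊥ ∧
      ρ.card = G.minCut t - ω + 1 := by
  classical
  obtain ⟨B, hB, hcard⟩ := G.exists_isCut_card_eq_minCut ht
  -- Only `ω - 1` channels of `B` remain outside `ρ`, too few to make room for `ω` dimensions of
  -- messages disjoint from the error space of `ρ`.
  obtain ⟨ρ, hρB, hρ⟩ := Finset.exists_subset_card_eq (s := B) (n := G.minCut t - ω + 1) (by omega)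
  refine ⟨ρ, fun hbot => ?_, hρ⟩
  have hsplit : c.errorSpace t B = c.errorSpace t ρ ⊔ c.errorSpace t (B \ ρ) := by
    rw [errorSpace, errorSpace, errorSpace, ← Submodule.span_union, ← Set.image_union,
      ← Finset.coe_union, Finset.union_sdiff_of_subset hρB]
  have h₁ := Submodule.finrank_sup_add_finrank_inf_eq (c.errorSpace t ρ) (c.messageSpace t)
  rw [hbot, finrank_bot, hdim] at h₁
  have h₂ : Module.finrank F ↥(c.errorSpace t ρ ⊔ c.messageSpace t) ≤
      Module.finrank F (c.errorSpace t B) :=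
    Submodule.finrank_mono (sup_le (hsplit ▸ le_sup_left) (c.messageSpace_le_errorSpace hB))
  have h₃ := Submodule.finrank_add_le_finrank_add_finrank (c.errorSpace t ρ)
    (c.errorSpace t (B \ ρ))
  rw [← hsplit] at h₃
  have h₄ := c.finrank_errorSpace_le t (B \ ρ)
  rw [Finset.card_sdiff_of_subset hρB] at h₄
  omega

theorem minDist_eq_of_exists (c : G.Code ω F) (t : V) {n : ℕ}
    (h : ∃ ρ : Finset E, c.errorSpace t ρ ⊓ c.messageSpace t ≠ ⊥ ∧ ρ.card = n + 1)
    (hle : ∀ ρ : Finset E, ρ.card ≤ n → c.errorSpace t ρ ⊓ c.messageSpace t = ⊥) :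
    c.minDist t = n + 1 := by
  refine le_antisymm (Nat.sInf_le h) (le_csInf ⟨_, h⟩ ?_)
  rintro m ⟨ρ, hρ, rfl⟩
  by_contra! hlt
  exact hρ (hle ρ (by omega))

theorem finrank_messageSpace_of_linearIndepOn (c : G.Code ω F) {t : V} (T : Finset (Fin ω))
    (h : LinearIndepOn F (c.decodingMatrix t).row (Sum.inl '' (T : Set (Fin ω)))) :
    T.card ≤ Module.finrank F (c.messageSpace t) :=
  card_le_finrank_of_linearIndepOn_image Sum.inl_injective h fun i _ =>
    Submodule.subset_span ⟨i, rfl⟩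

theorem errorSpace_inf_messageSpace_eq_bot (c : G.Code ω F) {t : V} {ρ : Finset E}
    (h : LinearIndepOn F (c.decodingMatrix t).row
      ((Finset.univ.disjSum ρ : Finset (Fin ω ⊕ E)) : Set (Fin ω ⊕ E))) :
    c.errorSpace t ρ ⊓ c.messageSpace t = ⊥ := by
  rw [← disjoint_iff]
  let u : Set ((Finset.univ.disjSum ρ : Finset (Fin ω ⊕ E)) : Set (Fin ω ⊕ E)) := {x | x.1.isRight}
  refine (LinearIndependent.disjoint_span_image h (disjoint_compl_right (a := u))).mono
    (Submodule.span_mono ?_) (Submodule.span_mono ?_)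
  · rintro _ ⟨e, he, rfl⟩
    exact ⟨⟨Sum.inr e, by simpa using he⟩, rfl, rfl⟩
  · rintro _ ⟨i, rfl⟩
    exact ⟨⟨Sum.inl i, by simp⟩, by simp [u], rfl⟩

theorem minDist_eq_of_forall_linearIndepOn [Finite V] (c : G.Code ω F) (hω : 1 ≤ ω) {t : V}
    (ht : t ≠ G.source) (hC : ω ≤ G.minCut t)
    (h : ∀ ρ ∈ G.redundancyPatterns ω F t, LinearIndepOn F (c.decodingMatrix t).row
      ((Finset.univ.disjSum ρ : Finset (Fin ω ⊕ E)) : Set (Fin ω ⊕ E))) :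
    Module.finrank F (c.messageSpace t) = ω ∧ c.minDist t = G.minCut t - ω + 1 := by
  have hdim : Module.finrank F (c.messageSpace t) = ω := by
    refine le_antisymm ((finrank_range_le_card _).trans_eq (Fintype.card_fin ω)) ?_
    -- The hypothesis says nothing unless `R_t(δ_t)` is nonempty; dominating the empty pattern shows
    -- that it is.
    obtain ⟨ρ, hρ, -⟩ := G.exists_mem_redundancyPatterns (ω := ω) (F := F) ht (ρ := ∅) (by simp)
    refine le_of_eq_of_le ?_ (c.finrank_messageSpace_of_linearIndepOn Finset.univ
      ((h ρ hρ).mono ?_))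
    · simp
    · rintro _ ⟨i, -, rfl⟩
      simp
  refine ⟨hdim, c.minDist_eq_of_exists t
    (c.exists_errorSpace_inf_messageSpace_ne_bot hω ht hC hdim) fun ρ hρ => ?_⟩
  obtain ⟨ρ', hρ', hdom⟩ := G.exists_mem_redundancyPatterns (F := F) ht hρ
  rw [eq_bot_iff, ← c.errorSpace_inf_messageSpace_eq_bot (h ρ' hρ')]
  exact inf_le_inf_right _ (hdom c)

theorem minDist_eq_one [Finite V] (c : G.Code ω F) {t : V} (ht : t ≠ G.source) (hC : 1 ≤ G.minCut t)
    (hdim : Module.finrank F (c.messageSpace t) = G.minCut t) : c.minDist t = 1 := by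
  obtain ⟨B, hB, hcard⟩ := G.exists_isCut_card_eq_minCut ht
  -- Equality makes any single channel of `B` with nonzero row an undetectable error.
  have heq : c.messageSpace t = c.errorSpace t B :=
    Submodule.eq_of_le_of_finrank_le (c.messageSpace_le_errorSpace hB)
      ((c.finrank_errorSpace_le t B).trans (hcard.trans hdim.symm).le)
  refine c.minDist_eq_of_exists t (n := 0) ?_ fun ρ hρ => ?_
  · obtain ⟨e, he, hne⟩ : ∃ e ∈ B, (c.decodingMatrix t).row (Sum.inr e) ≠ 0 := by
      by_contra! h0
      have hbot : c.errorSpace t B = ⊥ := by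
        rw [errorSpace, Submodule.span_eq_bot]
        rintro _ ⟨e, he, rfl⟩
        exact h0 e he
      rw [heq, hbot, finrank_bot] at hdim
      omega
    refine ⟨{e}, fun hbot => hne ?_, rfl⟩
    rw [heq] at hbot
    rw [← Submodule.mem_bot F, ← hbot]
    exact ⟨Submodule.subset_span ⟨e, by simp, rfl⟩, Submodule.subset_span ⟨e, he, rfl⟩⟩
  · rw [Finset.card_eq_zero.1 (Nat.le_zero.1 hρ)]
    simp [errorSpace]

end Code

end AcyclicNetwork

/-! ### The main theorem -/

open Classical in
theorem mainTheorem4 {V E : Type*} [Fintype V] [Fintype E] (G : AcyclicNetwork V E)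
    (ω : ℕ) (hω : 1 ≤ ω) (F : Type*) [Field F]
    (hF : (((∑ t : V with t ≠ G.source ∧ ω ≤ G.minCut t, (G.redundancyPatterns ω F t).ncard) +
        {t : V | t ≠ G.source ∧ G.minCut t < ω}.ncard : ℕ) : ℕ∞) < ENat.card F) :
    ∃ c : G.Code ω F, c.IsBroadcastMDS := by
  choose! T hT using fun (t : V) (h : G.minCut t < ω) =>
    Finset.exists_subset_card_eq (s := (Finset.univ : Finset (Fin ω))) (n := G.minCut t)
      (by simpa using h.le)
  -- `Q₁` and `Q₂` list the requirements counted by the two terms of the field-size bound.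
  let Q₁ : Finset (V × Finset (Fin ω ⊕ E)) :=
    (Finset.univ.filter fun t => t ≠ G.source ∧ ω ≤ G.minCut t).biUnion fun t =>
      (G.redundancyPatterns ω F t).toFinset.image fun ρ => (t, Finset.univ.disjSum ρ)
  let Q₂ : Finset (V × Finset (Fin ω ⊕ E)) :=
    {t : V | t ≠ G.source ∧ G.minCut t < ω}.toFinset.image fun t => (t, (T t).disjSum ∅)
  have hcard : (Q₁ ∪ Q₂).card ≤
      (∑ t : V with t ≠ G.source ∧ ω ≤ G.minCut t, (G.redundancyPatterns ω F t).ncard) +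
        {t : V | t ≠ G.source ∧ G.minCut t < ω}.ncard := by
    refine (Finset.card_union_le _ _).trans (add_le_add ?_ ?_)
    · refine Finset.card_biUnion_le.trans (Finset.sum_le_sum fun t _ => ?_)
      rw [Set.ncard_eq_toFinset_card']
      exact Finset.card_image_le
    · rw [Set.ncard_eq_toFinset_card']
      exact Finset.card_image_le
  obtain ⟨c, hc⟩ := G.exists_code_linearIndepOn F (Q₁ ∪ Q₂)
    (lt_of_le_of_lt (by exact_mod_cast hcard) hF) (by
      intro q hq
      rcases Finset.mem_union.1 hq with hq | hq
      · obtain ⟨t, ht, hq⟩ := Finset.mem_biUnion.1 hq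
        obtain ⟨ρ, hρ, rfl⟩ := Finset.mem_image.1 hq
        obtain ⟨hts, htC⟩ := (Finset.mem_filter.1 ht).2
        obtain ⟨hρ₁, hρ₂⟩ := Set.mem_toFinset.1 hρ
        refine ⟨hts, G.isLinked_of_card_le (F := F) hts ?_ ?_⟩
        · rw [Finset.card_disjSum, Finset.card_univ, Fintype.card_fin, hρ₁]
          omega
        · rw [Finset.toRight_disjSum, hρ₁, hρ₂]
      · obtain ⟨t, ht, rfl⟩ := Finset.mem_image.1 hq
        obtain ⟨hts, htC⟩ := Set.mem_toFinset.1 ht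
        refine ⟨hts, G.isLinked_of_card_le (F := F) hts ?_ ?_⟩
        · rw [Finset.card_disjSum, (hT t htC).2, Finset.card_empty, add_zero]
        · rw [Finset.toRight_disjSum, Finset.card_empty]
          exact Nat.zero_le _)
  have h₁ : ∀ t, t ≠ G.source → ω ≤ G.minCut t →
      Module.finrank F (c.messageSpace t) = ω ∧ c.minDist t = G.minCut t - ω + 1 := by
    intro t hts htC
    refine c.minDist_eq_of_forall_linearIndepOn hω hts htC fun ρ hρ => ?_
    exact hc (t, _) (Finset.mem_union_left _ (Finset.mem_biUnion.2
      ⟨t, Finset.mem_filter.2 ⟨Finset.mem_univ t, hts, htC⟩,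
        Finset.mem_image_of_mem _ (Set.mem_toFinset.2 hρ)⟩))
  have h₂ : ∀ t, t ≠ G.source → G.minCut t < ω →
      Module.finrank F (c.messageSpace t) = G.minCut t := by
    intro t hts htC
    refine le_antisymm (c.finrank_messageSpace_le_minCut hts) ?_
    have h := hc (t, (T t).disjSum ∅) (Finset.mem_union_right _
      (Finset.mem_image_of_mem _ (Set.mem_toFinset.2 ⟨hts, htC⟩)))
    rw [Finset.disjSum_empty, Finset.coe_map] at h
    exact (hT t htC).2.symm.le.trans (c.finrank_messageSpace_of_linearIndepOn (T t) h)
  refine ⟨c, fun t hts => ?_, fun t hts htC => ?_⟩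
  · rcases le_or_gt ω (G.minCut t) with h | h
    · rw [(h₁ t hts h).1, min_eq_left h]
    · rw [h₂ t hts h, min_eq_right h.le]
  · split_ifs with h
    · exact (h₁ t hts h).2
    · exact c.minDist_eq_one hts htC (h₂ t hts (not_le.1 h))
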